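/- For complex numbers $a,b,c$ with $c\ne 0,-1,-2,\dots$ let $${}_2F_1(a,b;c;z)=\sum_{n=0}^\infty\frac{(a)_n(b)_n}{(c)_n\,n!}z^n,\qquad |z|<1,$$ where $(x)_0=1$ and $(x)_n=x(x+1)\cdots(x+n-1)$ for $n\ge1$. An analytic function $f$ on the unit disk $\mathbb D=\{z\in\mathbb C:|z|<1\}$ with $f(0)=0$ and $f'(0)=1$ is called starlike of order $\alpha$ if $f(z)\neq 0$ for $z\in\mathbb D\setminus\{0\}$ and $\Re\big[zf'(z)/f(z)\big]>\alpha$ for all $z\in\mathbb D$ (the quotient being understood as $1$ at $z=0$). Theorem. Let $\alpha$ be a real constant with $0\le\alpha<1$ and let $a,b,c$ be complex numbers with $ab\ne0$ and $c\ne0,-1,-2,\dots$. Then the shifted hypergeometric function $z\,{}_2F_1(a,b;c;z)$ is starlike of order $\alpha$ if the following conditions are satisfied: (i) $p=a+b+1-c$ is a real number; (ii) $\Re[ab]>p(1-\alpha)$; (iii) $L\ge0$, $N\ge0$ and $LN-M^2\ge0$, where $$L=\frac{\Re[ab]}{1-\alpha}+p(1-2\alpha)-|a|^2-|b|^2+|c-1|^2-4\,\Im[a]\,\Im[b],$$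 $$M=\frac{\Im\big[ab(\bar a+\bar b-2+2\alpha)\big]}{1-\alpha},$$ $$N=\frac{\Re[ab]}{1-\alpha}+p(1-2\alpha)-|a|^2-|b|^2+|c-1|^2-\Big(2\Re[a]-\frac{|a|^2}{1-\alpha}\Big)\Big(2\Re[b]-\frac{|b|^2}{1-\alpha}\Big).$$ -/

import Mathlib

/-- `f` is starlike of order `α`: it is analytic on the open unit disk, normalized by
`f 0 = 0`, `f' 0 = 1`, and `Re (z f'(z) / f(z)) > α` on the disk.  The quotient has a removable
singularity with value `1` at the origin, so the inequality is stated at the points `z ≠ 0`,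
where `f` must not vanish in order that the quotient be defined. -/
def StarlikeOfOrder (α : ℝ) (f : ℂ → ℂ) : Prop :=
  AnalyticOnNhd ℂ f (Metric.ball 0 1) ∧ f 0 = 0 ∧ deriv f 0 = 1 ∧
    ∀ z ∈ Metric.ball (0 : ℂ) 1, z ≠ 0 → f z ≠ 0 ∧ α < (z * deriv f z / f z).re

/-- The shifted hypergeometric function `z ↦ z ₂F₁(a, b; c; z)`. -/
noncomputable def shiftedHypergeometric (a b c z : ℂ) : ℂ :=
  z * ordinaryHypergeometric a b c z

/-! Write `f = z F` and `w = z F'/F`, so that `z f'/f = 1 + w`; with `β = 1 - α`, the claim is `Re w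
> -β`. If it fails, take a failure point `z₀` of least modulus. There `Re w = -β`, and the
half-plane form of Jack's lemma gives `z₀ w'(z₀) = -s` with `s ≥ |w|²/(2β)`. The hypergeometric
equation becomes a Riccati equation `A = z₀ B`, where `A = -s + w² + (c-1)w` and `B = -s + w² +
(a+b)w + ab`. Condition (iii), with (i) and (ii), gives `|B| ≤ |A|`. Since `|z₀| < 1`, this forces
`A = B = 0`, so `B - A = p w + ab` vanishes. But its real part is `Re(ab) - pβ`, positive by (ii).
-/

open Filter Topology Metric

/-! ### Boundary Schwarz lemma in the disk and the half-plane -/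

/-- A real function vanishing at `0` and nonnegative to the right of `0` has nonnegative derivative
there. -/
lemma HasDerivAt.nonneg_of_eventually_nonneg_right {g : ℝ → ℝ} {g' : ℝ} (hg : HasDerivAt g g' 0)
    (h0 : g 0 = 0) (hpos : ∀ᶠ t in 𝓝[>] (0 : ℝ), 0 ≤ g t) : 0 ≤ g' := by
  have h1 : Tendsto (slope g 0) (𝓝[>] 0) (𝓝 g') :=
    (hasDerivAt_iff_tendsto_slope.1 hg).mono_left (nhdsWithin_mono _ fun x hx => ne_of_gt hx)
  refine ge_of_tendsto h1 ?_
  filter_upwards [hpos, self_mem_nhdsWithin] with t ht (ht0 : 0 < t)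
  rw [slope_def_field, h0]
  exact div_nonneg (by linarith) (by linarith)

/-- For a point `z₀ ≠ 0`, a segment leaving `z₀` in the direction `z₀ (-1 + k i)` starts inside the
disk through `z₀`. -/
lemma eventually_norm_segment_lt {z₀ : ℂ} (hz₀ : z₀ ≠ 0) (k : ℝ) :
    ∀ᶠ t : ℝ in 𝓝[>] (0 : ℝ), ‖z₀ * (1 + t * (-1 + k * Complex.I))‖ < ‖z₀‖ := by
  have h : ∀ᶠ t : ℝ in 𝓝[>] (0 : ℝ), t < 2 / (1 + k ^ 2) :=
    nhdsWithin_le_nhds (Iio_mem_nhds (by positivity))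
  filter_upwards [h, self_mem_nhdsWithin] with t ht (ht0 : 0 < t)
  rw [norm_mul]
  have h1 : ‖(1 + t * (-1 + k * Complex.I) : ℂ)‖ < 1 := by
    rw [← sq_lt_one_iff₀ (norm_nonneg _), ← Complex.normSq_eq_norm_sq, Complex.normSq_apply]
    simp
    rw [lt_div_iff₀ (by positivity)] at ht
    nlinarith
  have := norm_pos_iff.2 hz₀
  nlinarith

/-- **Boundary Schwarz lemma** (Jack, Clunie): if `φ` fixes `0`, maps the disk through `z₀` to the
unit disk and `|φ z₀| = 1`, then `z₀ φ'(z₀) / φ(z₀)` is real and at least `1`. -/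
lemma exists_conj_mul_deriv_eq_of_norm_eq_one {φ : ℂ → ℂ} {φ' z₀ : ℂ} (hz₀ : z₀ ≠ 0)
    (hd : DifferentiableOn ℂ φ (ball 0 ‖z₀‖)) (hφ' : HasDerivAt φ φ' z₀) (h0 : φ 0 = 0)
    (hmaps : ∀ z ∈ ball (0 : ℂ) ‖z₀‖, ‖φ z‖ ≤ 1) (h1 : ‖φ z₀‖ = 1) :
    ∃ m : ℝ, 1 ≤ m ∧ (starRingEnd ℂ) (φ z₀) * (z₀ * φ') = m := by
  set X := (starRingEnd ℂ) (φ z₀) * (z₀ * φ') with hX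
  have hn := norm_pos_iff.2 hz₀
  -- By Schwarz, `|1 + t(-1+ki)|² - |φ(z₀(1 + t(-1+ki)))|²` is nonnegative for small `t > 0`. It
  -- vanishes at `t = 0`, with derivative `2(Re X + k Im X - 1)` there. Letting `k` vary forces `Im
  -- X = 0`.
  have key : ∀ k : ℝ, 1 - X.re - k * X.im ≤ 0 := by
    intro k
    have hc : HasDerivAt (fun t : ℝ => (1 + t * (-1 + k * Complex.I) : ℂ))
        (-1 + k * Complex.I) 0 := by
      simpa using ((Complex.ofRealCLM.hasDerivAt (x := (0 : ℝ))).mul_const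
        (-1 + k * Complex.I)).const_add (1 : ℂ)
    have hγ : HasDerivAt (fun t : ℝ => z₀ * (1 + t * (-1 + k * Complex.I) : ℂ))
        (z₀ * (-1 + k * Complex.I)) 0 := hc.const_mul z₀
    have hφγ : HasDerivAt (fun t : ℝ => φ (z₀ * (1 + t * (-1 + k * Complex.I) : ℂ)))
        (φ' * (z₀ * (-1 + k * Complex.I))) 0 := by
      refine HasDerivAt.comp (0 : ℝ) (h₂ := φ) ?_ hγ
      simpa using hφ'
    have hg := hc.norm_sq.sub hφγ.norm_sq
    have := hg.nonneg_of_eventually_nonneg_right (by simp [h1]) ?_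
    · simp only [Complex.inner, Complex.ofReal_zero, zero_mul, add_zero, mul_one] at this
      have e : (starRingEnd ℂ) (φ z₀) * (φ' * (z₀ * (-1 + k * Complex.I))) =
        X * (-1 + k * Complex.I) := by rw [hX]; ring
      rw [mul_comm _ ((starRingEnd ℂ) (φ z₀)), e] at this
      simp at this
      linarith
    · filter_upwards [eventually_norm_segment_lt hz₀ k] with t ht
      have hs := Complex.dist_le_div_mul_dist_of_mapsTo_ball (R₂ := 1) hd
        (fun z hz => by simpa [h0] using hmaps z hz) (mem_ball_zero_iff.2 ht)
      rw [h0, dist_zero_right, dist_zero_right, norm_mul] at hs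
      have hs' : ‖φ (z₀ * (1 + t * (-1 + k * Complex.I)))‖ ≤
          ‖(1 + t * (-1 + k * Complex.I) : ℂ)‖ := by
        refine hs.trans_eq ?_
        field_simp
      simp only [Pi.sub_apply, sub_nonneg]
      gcongr
  have him : X.im = 0 := by
    by_contra hne
    have := key (-(X.re) / X.im)
    field_simp at this
    linarith
  refine ⟨X.re, by simpa [him] using key 0, Complex.ext (by simp) (by simp [him])⟩

/-- The half-plane form of the boundary Schwarz lemma. -/
lemma exists_mul_deriv_eq_neg_of_re_eq {h : ℂ → ℂ} {h' z₀ : ℂ} {β : ℝ} (hβ : 0 < β)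
    (hz₀ : z₀ ≠ 0) (hd : DifferentiableOn ℂ h (ball 0 ‖z₀‖)) (hh' : HasDerivAt h h' z₀)
    (h0 : h 0 = 0) (hre : ∀ z ∈ ball (0 : ℂ) ‖z₀‖, -β < (h z).re) (hre₀ : (h z₀).re = -β) :
    ∃ s : ℝ, ‖h z₀‖ ^ 2 / (2 * β) ≤ s ∧ z₀ * h' = -s := by
  have hne : ∀ z : ℂ, -β ≤ z.re → z + 2 * β ≠ 0 := by
    intro z hz h
    have := congrArg Complex.re h
    simp at this
    linarith
  have hw0 : h z₀ ≠ 0 := by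
    intro h
    rw [h] at hre₀
    simp at hre₀
    linarith
  have hw2 := hne (h z₀) hre₀.ge
  -- On the line `Re = -β`, conjugation is `ζ ↦ -(ζ + 2β)`. Hence `ζ/(ζ + 2β)`, which maps the
  -- half-plane into the disk and fixes `0`, has modulus 1 at `h z₀`.
  have c1 : (starRingEnd ℂ) (h z₀) = -(h z₀ + 2 * β) := by
    apply Complex.ext <;> simp [hre₀]; ring
  have c2 : (starRingEnd ℂ) (h z₀ + 2 * β) = -h z₀ := by
    apply Complex.ext <;> simp [hre₀]; ring
  have hder : HasDerivAt (fun z => h z / (h z + 2 * β)) (2 * β * h' / (h z₀ + 2 * β) ^ 2) z₀ := by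
    convert! hh'.div (hh'.add_const (2 * β : ℂ)) hw2 using 1
    ring
  have hle : ∀ z : ℂ, -β ≤ z.re → ‖z / (z + 2 * β)‖ ≤ 1 := by
    intro z hz
    rw [norm_div, div_le_one (norm_pos_iff.2 (hne z hz)), ← sq_le_sq₀ (norm_nonneg _)
      (norm_nonneg _), ← Complex.normSq_eq_norm_sq, ← Complex.normSq_eq_norm_sq,
      Complex.normSq_apply, Complex.normSq_apply]
    simp
    nlinarith
  obtain ⟨m, hm, hX⟩ := exists_conj_mul_deriv_eq_of_norm_eq_one hz₀
    (φ := fun z => h z / (h z + 2 * β))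
    (hd.div (hd.add_const _) fun z hz => hne _ (hre z hz).le) hder (by simp [h0])
    (fun z hz => hle _ (hre z hz).le) (by
      have : ‖h z₀ + 2 * β‖ = ‖h z₀‖ := by
        rw [← Complex.norm_conj, c2, norm_neg]
      rw [norm_div, this, div_self (norm_ne_zero_iff.2 hw0)])
  have hsq : (‖h z₀‖ ^ 2 : ℂ) = -(h z₀ * (h z₀ + 2 * β)) := by
    rw [← Complex.mul_conj', c1]; ring
  refine ⟨m * (‖h z₀‖ ^ 2 / (2 * β)), le_mul_of_one_le_left (by positivity) hm, ?_⟩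
  have hβ' : (β : ℂ) ≠ 0 := by exact_mod_cast hβ.ne'
  push_cast
  rw [hsq, ← hX]
  simp only [map_div₀, c1, c2]
  field_simp

/-! ### The boundary inequality -/

/-- Complete the square after multiplying by `L`; if `L = 0`, the discriminant condition forces `M =
0`. -/
lemma hypergeometric_boundary_quadratic_nonneg {L M N β t : ℝ} (hL : 0 ≤ L) (hN : 0 ≤ N)
    (hLMN : 0 ≤ L * N - M ^ 2) : 0 ≤ L * t ^ 2 + 2 * M * β * t + N * β ^ 2 := by
  rcases hL.eq_or_lt with rfl | hL
  · have : M = 0 := by nlinarith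
    subst this
    simp
    positivity
  · refine nonneg_of_mul_nonneg_right (a := L) ?_ hL
    nlinarith [sq_nonneg (L * t + M * β), mul_nonneg hLMN (sq_nonneg β)]

/-- On the line `Re w = -(1 - α)`, with `-s` in place of `z w'`, the factor of `z` in the Riccati
equation of the hypergeometric function is at most the left-hand side in modulus. -/
lemma hypergeometric_boundary_norm_le {α p L M N s : ℝ} {a b c w : ℂ} (hα₁ : α < 1)
    (hp : (p : ℂ) = a + b + 1 - c) (hre : p * (1 - α) < (a * b).re)
    (hL : L = (a * b).re / (1 - α) + p * (1 - 2 * α) - ‖a‖ ^ 2 - ‖b‖ ^ 2 + ‖c - 1‖ ^ 2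
      - 4 * a.im * b.im)
    (hM : M = (a * b * ((starRingEnd ℂ) a + (starRingEnd ℂ) b - 2 + 2 * (α : ℂ))).im / (1 - α))
    (hN : N = (a * b).re / (1 - α) + p * (1 - 2 * α) - ‖a‖ ^ 2 - ‖b‖ ^ 2 + ‖c - 1‖ ^ 2
      - (2 * a.re - ‖a‖ ^ 2 / (1 - α)) * (2 * b.re - ‖b‖ ^ 2 / (1 - α)))
    (hL₀ : 0 ≤ L) (hN₀ : 0 ≤ N) (hLMN : 0 ≤ L * N - M ^ 2)
    (hw : w.re = -(1 - α)) (hs : ‖w‖ ^ 2 / (2 * (1 - α)) ≤ s) :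
    ‖-s + w ^ 2 + (a + b) * w + a * b‖ ≤ ‖-s + w ^ 2 + (c - 1) * w‖ := by
  have hβ : 0 < 1 - α := by linarith
  generalize hβd : 1 - α = β at *
  obtain rfl : α = 1 - β := by linarith
  have hc : c = a + b + 1 - p := by rw [hp]; ring
  -- `|A|² - |B|²` is affine in `s` with slope `2 Re(pw + ab) = 2(Re(ab) - pβ)`. At the extremal `s
  -- = |w|²/(2β)` it is exactly this quadratic form in `-Im w` and `β`.
  have hQ := hypergeometric_boundary_quadratic_nonneg (β := β) (t := -w.im) hL₀ hN₀ hLMN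
  have hS : 0 ≤ 2 * (s - ‖w‖ ^ 2 / (2 * β)) * ((a * b).re - p * β) :=
    mul_nonneg (by linarith) (by linarith)
  subst hc
  rw [← sq_le_sq₀ (norm_nonneg _) (norm_nonneg _), ← sub_nonneg]
  refine (add_nonneg hQ hS).trans_eq ?_
  rw [hL, hM, hN]
  simp only [← Complex.normSq_eq_norm_sq, Complex.normSq_apply]
  obtain ⟨a1, a2⟩ := a
  obtain ⟨b1, b2⟩ := b
  obtain ⟨x, y⟩ := w
  simp at hw ⊢
  subst hw
  simp [pow_two]
  field_simp
  ring

/-! ### The first point of failure -/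

/-- If `1 + z F'/F` has nonnegative real part in the disk through `z₀`, then `|z F(z)|` increases
along the radius to `z₀`, so that `F` does not vanish at `z₀`. -/
lemma ne_zero_of_re_logDeriv_ge {F : ℂ → ℂ} {z₀ : ℂ} (hz₀ : z₀ ≠ 0)
    (hd : ∀ z, ‖z‖ ≤ ‖z₀‖ → DifferentiableAt ℂ F z)
    (hF : ∀ z ∈ ball (0 : ℂ) ‖z₀‖, F z ≠ 0 ∧ -1 ≤ (z * deriv F z / F z).re) : F z₀ ≠ 0 := by
  intro h0
  have hn := norm_pos_iff.2 hz₀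
  have hder : ∀ ρ ∈ Set.Icc (0 : ℝ) 1, HasDerivAt (fun ρ : ℝ => ‖(ρ : ℂ) * F (ρ * z₀)‖ ^ 2)
      (2 * inner ℝ ((ρ : ℂ) * F (ρ * z₀)) (F (ρ * z₀) + ρ * (deriv F (ρ * z₀) * z₀))) ρ := by
    intro ρ hρ
    have h1 : HasDerivAt (fun ρ : ℝ => (ρ : ℂ)) 1 ρ := Complex.ofRealCLM.hasDerivAt
    have h2 : HasDerivAt (fun ρ : ℝ => F (ρ * z₀)) (deriv F (ρ * z₀) * z₀) ρ := by
      refine HasDerivAt.comp ρ (h₂ := F) (hd _ ?_).hasDerivAt (by simpa using h1.mul_const z₀)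
      rw [norm_mul, Complex.norm_real, Real.norm_of_nonneg hρ.1]
      nlinarith [hρ.2]
    simpa using (h1.mul h2).norm_sq
  have hmono : MonotoneOn (fun ρ : ℝ => ‖(ρ : ℂ) * F (ρ * z₀)‖ ^ 2) (Set.Icc 0 1) := by
    refine monotoneOn_of_deriv_nonneg (convex_Icc 0 1)
      (fun ρ hρ => (hder ρ hρ).continuousAt.continuousWithinAt)
      (fun ρ hρ => (hder ρ (interior_subset hρ)).differentiableAt.differentiableWithinAt) ?_
    intro ρ hρ
    rw [(hder ρ (interior_subset hρ)).deriv]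
    rw [interior_Icc] at hρ
    have hmem : (ρ : ℂ) * z₀ ∈ ball (0 : ℂ) ‖z₀‖ := by
      rw [mem_ball_zero_iff, norm_mul, Complex.norm_real, Real.norm_of_nonneg hρ.1.le]
      nlinarith [hρ.2]
    obtain ⟨h1, h2⟩ := hF _ hmem
    have e : (starRingEnd ℂ) ((ρ : ℂ) * F (ρ * z₀)) * (F (ρ * z₀) + ρ * (deriv F (ρ * z₀) * z₀)) =
        ((ρ * ‖F (ρ * z₀)‖ ^ 2 : ℝ) : ℂ) * (1 + ρ * z₀ * deriv F (ρ * z₀) / F (ρ * z₀)) := by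
      push_cast
      rw [← Complex.mul_conj']
      simp
      field_simp
    rw [Complex.inner, mul_comm, mul_comm _ ((starRingEnd ℂ) _), e, Complex.re_ofReal_mul,
      Complex.add_re, Complex.one_re]
    have := hρ.1
    exact mul_nonneg (mul_nonneg (by positivity) (by linarith)) (by norm_num)
  have := hmono (a := 1 / 2) (b := 1) ⟨by norm_num, by norm_num⟩ ⟨by norm_num, by norm_num⟩
    (by norm_num)
  have hz : F (((1 / 2 : ℝ) : ℂ) * z₀) ≠ 0 := (hF _ (by
    rw [mem_ball_zero_iff, norm_mul, Complex.norm_real]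
    norm_num
    linarith)).1
  have h3 : 0 < ‖((1 / 2 : ℝ) : ℂ) * F (((1 / 2 : ℝ) : ℂ) * z₀)‖ ^ 2 := by
    have : ((1 / 2 : ℝ) : ℂ) * F (((1 / 2 : ℝ) : ℂ) * z₀) ≠ 0 := mul_ne_zero (by simp) hz
    positivity
  simp only [Complex.ofReal_one, one_mul, h0, norm_zero] at this
  linarith

/-- If `Re (z F'/F) > -β` fails somewhere in the unit disk, then equality holds at a point such that
the inequality is valid at all points of smaller modulus. -/
lemma exists_first_re_logDeriv_eq {F : ℂ → ℂ} {β : ℝ} (hβ : 0 < β) (hβ₁ : β ≤ 1)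
    (hd : DifferentiableOn ℂ F (ball 0 1)) (hF0 : F 0 ≠ 0)
    (hbad : ∃ z ∈ ball (0 : ℂ) 1, F z = 0 ∨ (z * deriv F z / F z).re ≤ -β) :
    ∃ z₀ ∈ ball (0 : ℂ) 1, z₀ ≠ 0 ∧ F z₀ ≠ 0 ∧ (z₀ * deriv F z₀ / F z₀).re = -β ∧
      ∀ z ∈ ball (0 : ℂ) ‖z₀‖, F z ≠ 0 ∧ -β < (z * deriv F z / F z).re := by
  have hdA : ∀ z ∈ ball (0 : ℂ) 1, DifferentiableAt ℂ F z := fun z hz =>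
    hd.differentiableAt (isOpen_ball.mem_nhds hz)
  have hd' : ∀ z ∈ ball (0 : ℂ) 1, ContinuousAt (deriv F) z := fun z hz =>
    (hd.deriv isOpen_ball).continuousOn.continuousAt (isOpen_ball.mem_nhds hz)
  -- `Φ = |F|² (Re w + β)` away from the zeros of `F`, but it is continuous across them, so the
  -- failure set is relatively closed.
  set Φ : ℂ → ℝ := fun z => (z * deriv F z * (starRingEnd ℂ) (F z)).re + β * ‖F z‖ ^ 2 with hΦ
  have hiff : ∀ z, Φ z ≤ 0 ↔ F z = 0 ∨ (z * deriv F z / F z).re ≤ -β := by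
    intro z
    by_cases h : F z = 0
    · simp [hΦ, h]
    · have hpos : 0 < ‖F z‖ ^ 2 := by positivity
      have e : Φ z = ((z * deriv F z / F z).re + β) * ‖F z‖ ^ 2 := by
        have : z * deriv F z * (starRingEnd ℂ) (F z) =
            ((‖F z‖ ^ 2 : ℝ) : ℂ) * (z * deriv F z / F z) := by
          push_cast
          rw [← Complex.mul_conj']
          field_simp
        rw [hΦ]
        simp only [this, Complex.re_ofReal_mul]
        ring
      rw [e]
      simp only [h, false_or]
      constructor
      · intro h'
        by_contra! h''
        have : 0 < ((z * deriv F z / F z).re + β) * ‖F z‖ ^ 2 := mul_pos (by linarith) hpos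
        linarith
      · intro h'
        exact mul_nonpos_of_nonpos_of_nonneg (by linarith) hpos.le
  have hΦc : ContinuousOn Φ (ball 0 1) := by
    intro z hz
    have h1 := (hdA z hz).continuousAt
    have h2 := hd' z hz
    exact ContinuousAt.continuousWithinAt (by fun_prop)
  obtain ⟨z₁, hz₁, hb⟩ := hbad
  rw [← hiff] at hb
  have hsub : closedBall (0 : ℂ) ‖z₁‖ ⊆ ball 0 1 :=
    closedBall_subset_ball (mem_ball_zero_iff.1 hz₁)
  have hcpt : IsCompact (closedBall (0 : ℂ) ‖z₁‖ ∩ Φ ⁻¹' Set.Iic 0) :=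
    (isCompact_closedBall _ _).of_isClosed_subset
      ((hΦc.mono hsub).preimage_isClosed_of_isClosed isClosed_closedBall isClosed_Iic)
      Set.inter_subset_left
  obtain ⟨z₀, ⟨hz₀, hΦ₀⟩, hmin⟩ := hcpt.exists_isMinOn ⟨z₁, by simp, hb⟩
    (continuous_norm.continuousOn)
  have hz₀1 := hsub hz₀
  have hne : z₀ ≠ 0 := by
    rintro rfl
    have : Φ 0 ≤ 0 := hΦ₀
    simp [hΦ] at this
    have : 0 < β * ‖F 0‖ ^ 2 := by positivity
    linarith
  have hgood : ∀ z ∈ ball (0 : ℂ) ‖z₀‖, F z ≠ 0 ∧ -β < (z * deriv F z / F z).re := by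
    intro z hz
    have : ¬ Φ z ≤ 0 := by
      intro h
      rw [mem_ball_zero_iff] at hz
      have h2 : ‖z₀‖ ≤ ‖z‖ := hmin ⟨by
        rw [mem_closedBall_zero_iff] at hz₀ ⊢
        linarith, h⟩
      linarith
    rw [hiff] at this
    push Not at this
    exact this
  -- `Φ z₀ ≤ 0` alone would allow a zero of `F`. Radial growth of `|z F|` excludes it, using `β ≤
  -- 1`.
  have hF₀ : F z₀ ≠ 0 := ne_zero_of_re_logDeriv_ge hne
    (fun z hz => hdA z (by
      rw [mem_ball_zero_iff] at hz₀1 ⊢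
      linarith))
    fun z hz => ⟨(hgood z hz).1, by linarith [(hgood z hz).2]⟩
  refine ⟨z₀, hz₀1, hne, hF₀, le_antisymm (((hiff z₀).1 hΦ₀).resolve_left hF₀) ?_, hgood⟩
  have h1 := (hdA z₀ hz₀1).continuousAt
  have h2 := hd' z₀ hz₀1
  have hcont : ContinuousAt (fun z => (z * deriv F z / F z).re) z₀ :=
    Complex.continuous_re.continuousAt.comp ((continuousAt_id.mul h2).div h1 hF₀)
  have hcl : z₀ ∈ closure (ball (0 : ℂ) ‖z₀‖) := by
    rw [closure_ball _ (norm_ne_zero_iff.2 hne)]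
    simp
  have : (𝓝[ball (0 : ℂ) ‖z₀‖] z₀).NeBot := mem_closure_iff_nhdsWithin_neBot.1 hcl
  refine ge_of_tendsto (x := 𝓝[ball (0 : ℂ) ‖z₀‖] z₀) (hcont.tendsto.mono_left nhdsWithin_le_nhds) ?_
  filter_upwards [self_mem_nhdsWithin] with z hz using (hgood z hz).2.le

/-! ### Power series and the hypergeometric equation -/

/-- The power series obtained by applying `z d/dz` to a power series that converges in the unit
disk. -/
lemma hasSum_mul_deriv_of_hasSum {u : ℕ → ℂ} {F : ℂ → ℂ}
    (hu : ∀ r : ℝ, 0 ≤ r → r < 1 → Summable fun n => ‖u n‖ * r ^ n)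
    (hF : ∀ z ∈ ball (0 : ℂ) 1, HasSum (fun n => u n * z ^ n) (F z)) {z : ℂ}
    (hz : z ∈ ball (0 : ℂ) 1) :
    HasSum (fun n : ℕ => n * u n * z ^ n) (z * deriv F z) := by
  rw [mem_ball_zero_iff] at hz
  obtain ⟨r, hzr, hr1⟩ := exists_between hz
  have hr0 : 0 ≤ r := (norm_nonneg z).trans hzr.le
  have hzr' : z ∈ ball (0 : ℂ) r := by simpa using hzr
  have h := Complex.hasSum_deriv_of_summable_norm (F := fun n w => u n * w ^ n) (U := ball 0 r)
    (hu r hr0 hr1) (fun n => by fun_prop) isOpen_ball (fun n w hw => by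
      rw [norm_mul, norm_pow]
      have := (mem_ball_zero_iff.1 hw).le
      gcongr) hzr'
  have e : deriv (fun w => ∑' n, u n * w ^ n) z = deriv F z := by
    refine Filter.EventuallyEq.deriv_eq ?_
    filter_upwards [isOpen_ball.mem_nhds hzr'] with w hw
    exact (hF w (ball_subset_ball hr1.le hw)).tsum_eq
  rw [e] at h
  refine (congrArg (fun g => HasSum g (z * deriv F z)) (funext fun n => ?_)).mp (h.mul_left z)
  rcases n with _ | n
  · simp
  · simp
    ring

lemma summable_natCast_mul_norm_pow {u : ℕ → ℂ}
    (hu : ∀ r : ℝ, 0 ≤ r → r < 1 → Summable fun n => ‖u n‖ * r ^ n) (r : ℝ) (hr0 : 0 ≤ r)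
    (hr1 : r < 1) : Summable fun n : ℕ => ‖n * u n‖ * r ^ n := by
  obtain ⟨q, hrq, hq1⟩ := exists_between hr1
  have hq0 : 0 < q := hr0.trans_lt hrq
  have hb : Tendsto (fun n : ℕ => (n : ℝ) * (r / q) ^ n) atTop (𝓝 0) :=
    tendsto_self_mul_const_pow_of_lt_one (by positivity) ((div_lt_one hq0).2 hrq)
  refine summable_of_isBigO_nat (hu q hq0.le hq1) ?_
  refine Asymptotics.IsBigO.of_bound 1 ?_
  filter_upwards [hb.eventually (gt_mem_nhds one_pos)] with n hn
  have e : ‖n * u n‖ * r ^ n = (n * (r / q) ^ n) * (‖u n‖ * q ^ n) := by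
    rw [norm_mul, Complex.norm_natCast, div_pow]
    field_simp
  rw [e, norm_mul, one_mul]
  refine mul_le_of_le_one_left (norm_nonneg _) ?_
  rw [Real.norm_of_nonneg (by positivity)]
  exact hn.le

lemma differentiableOn_of_hasSum {u : ℕ → ℂ} {F : ℂ → ℂ}
    (hu : ∀ r : ℝ, 0 ≤ r → r < 1 → Summable fun n => ‖u n‖ * r ^ n)
    (hF : ∀ z ∈ ball (0 : ℂ) 1, HasSum (fun n => u n * z ^ n) (F z)) :
    DifferentiableOn ℂ F (ball 0 1) := by
  intro z hz
  rw [mem_ball_zero_iff] at hz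
  obtain ⟨r, hzr, hr1⟩ := exists_between hz
  have hr0 : 0 ≤ r := (norm_nonneg z).trans hzr.le
  have hzr' : z ∈ ball (0 : ℂ) r := by simpa using hzr
  have h := Complex.differentiableOn_tsum_of_summable_norm (F := fun n w => u n * w ^ n)
    (U := ball 0 r) (hu r hr0 hr1) (fun n => by fun_prop) isOpen_ball (fun n w hw => by
      rw [norm_mul, norm_pow]
      have := (mem_ball_zero_iff.1 hw).le
      gcongr)
  refine ((h.differentiableAt (isOpen_ball.mem_nhds hzr')).congr_of_eventuallyEq
    ?_).differentiableWithinAt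
  filter_upwards [isOpen_ball.mem_nhds hzr'] with w hw
  exact (hF w (ball_subset_ball hr1.le hw)).tsum_eq.symm

lemma summable_norm_ordinaryHypergeometricCoefficient (a b c : ℂ) (r : ℝ) (hr0 : 0 ≤ r)
    (hr1 : r < 1) : Summable fun n => ‖ordinaryHypergeometricCoefficient a b c n‖ * r ^ n := by
  have hrad : 1 ≤ (ordinaryHypergeometricSeries ℂ a b c).radius := by
    -- Otherwise the series terminates, even when only `c` is a nonpositive integer, since `0⁻¹ =
    -- 0`.
    by_cases h : ∀ k : ℕ, (k : ℂ) ≠ -a ∧ (k : ℂ) ≠ -b ∧ (k : ℂ) ≠ -c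
    · exact (ordinaryHypergeometricSeries_radius_eq_one ℂ a b c h).ge
    · push Not at h
      obtain ⟨k, hk⟩ := h
      refine le_top.trans_eq (FormalMultilinearSeries.radius_eq_top_of_forall_image_add_eq_zero _
        (1 + k) fun n => ?_).symm
      exact ordinaryHypergeometricSeries_eq_zero_of_neg_nat a b c (by tauto) (by lia)
  lift r to NNReal using hr0
  have := (ordinaryHypergeometricSeries ℂ a b c).summable_norm_mul_pow
    (r := r) (lt_of_lt_of_le (by exact_mod_cast hr1) hrad)
  simpa [ordinaryHypergeometricSeries, FormalMultilinearSeries.ofScalars_norm] using this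

lemma hasSum_ordinaryHypergeometric (a b c : ℂ) {z : ℂ} (hz : z ∈ ball (0 : ℂ) 1) :
    HasSum (fun n => ordinaryHypergeometricCoefficient a b c n * z ^ n)
      (ordinaryHypergeometric a b c z) := by
  rw [ordinaryHypergeometric_eq_tsum]
  simp only [smul_eq_mul]
  refine Summable.hasSum (Summable.of_norm ?_)
  simpa only [norm_mul, norm_pow] using summable_norm_ordinaryHypergeometricCoefficient a b c
    ‖z‖ (norm_nonneg z) (mem_ball_zero_iff.1 hz)

lemma ordinaryHypergeometricCoefficient_succ (a b c : ℂ) (n : ℕ) (hc : c + n ≠ 0) :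
    (n + 1) * (c + n) * ordinaryHypergeometricCoefficient a b c (n + 1) =
      (a + n) * (b + n) * ordinaryHypergeometricCoefficient a b c n := by
  have hn : (n + 1 : ℂ) ≠ 0 := by exact_mod_cast n.succ_ne_zero
  simp only [ordinaryHypergeometricCoefficient, ascPochhammer_succ_eval, Nat.factorial_succ,
    Nat.cast_mul, mul_inv, Nat.cast_add, Nat.cast_one]
  field_simp

/-- The hypergeometric differential equation in terms of `θ = z d/dz`, namely
`θ (θ + c - 1) F = z (θ + a) (θ + b) F`. -/
lemma ordinaryHypergeometric_differential_equation {a b c : ℂ} (hc : ∀ n : ℕ, c ≠ -(n : ℂ))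
    {z : ℂ} (hz : z ∈ ball (0 : ℂ) 1) {F G : ℂ → ℂ} (hF : F = ordinaryHypergeometric a b c)
    (hG : G = fun w => w * deriv F w) :
    z * deriv G z + (c - 1) * G z =
      z * (z * deriv G z + (a + b) * G z + a * b * F z) := by
  set u := ordinaryHypergeometricCoefficient a b c with hu
  have s0 := summable_norm_ordinaryHypergeometricCoefficient a b c
  have s1 := summable_natCast_mul_norm_pow s0
  have h0 : ∀ w ∈ ball (0 : ℂ) 1, HasSum (fun n => u n * w ^ n) (F w) := fun w hw => by
    rw [hF]; exact hasSum_ordinaryHypergeometric a b c hw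
  have h1 : ∀ w ∈ ball (0 : ℂ) 1, HasSum (fun n : ℕ => n * u n * w ^ n) (G w) := fun w hw => by
    rw [hG]; exact hasSum_mul_deriv_of_hasSum s0 h0 hw
  have h2 := hasSum_mul_deriv_of_hasSum s1 h1 hz
  have hl := h2.add ((h1 z hz).mul_left (c - 1))
  have hr := ((h2.add ((h1 z hz).mul_left (a + b))).add ((h0 z hz).mul_left (a * b))).mul_left z
  -- The term `n = 0` on the left is zero; dropping it aligns the powers with the factor `z` on the
  -- right.
  rw [← hasSum_nat_add_iff' 1] at hl
  simp only [Finset.sum_range_one, Nat.cast_zero, zero_mul, mul_zero, add_zero, sub_zero] at hl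
  refine hl.unique ?_
  refine (congrArg (fun g => HasSum g _) (funext fun n => ?_)).mp hr
  have := ordinaryHypergeometricCoefficient_succ a b c n
    (fun h => hc n (eq_neg_of_add_eq_zero_left h))
  rw [← hu] at this
  push_cast
  linear_combination -z ^ (n + 1) * this

/-- The logarithmic derivative `w = z F'/F` of the hypergeometric function satisfies the Riccati
equation `z w' + w² + (c-1) w = z (z w' + (w+a)(w+b))`. -/
lemma ordinaryHypergeometric_riccati {a b c : ℂ} (hc : ∀ n : ℕ, c ≠ -(n : ℂ)) {z : ℂ}
    (hz : z ∈ ball (0 : ℂ) 1) {F w : ℂ → ℂ} (hF : F = ordinaryHypergeometric a b c)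
    (hd : DifferentiableOn ℂ F (ball 0 1))
    (hFz : F z ≠ 0) (hw : w = fun z => z * deriv F z / F z) :
    z * deriv w z + w z ^ 2 + (c - 1) * w z =
      z * (z * deriv w z + w z ^ 2 + (a + b) * w z + a * b) := by
  have ode := ordinaryHypergeometric_differential_equation hc hz hF rfl
  have hFd : HasDerivAt F (deriv F z) z :=
    (hd.differentiableAt (isOpen_ball.mem_nhds hz)).hasDerivAt
  have hGd : HasDerivAt (fun w => w * deriv F w) (deriv (fun w => w * deriv F w) z) z :=
    ((differentiableOn_id.mul (hd.deriv isOpen_ball)).differentiableAt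
      (isOpen_ball.mem_nhds hz)).hasDerivAt
  have hwd : deriv w z =
      (deriv (fun w => w * deriv F w) z * F z - z * deriv F z * deriv F z) / F z ^ 2 := by
    rw [hw]
    exact (hGd.div hFd hFz).deriv
  rw [hwd, hw]
  generalize deriv (fun w => w * deriv F w) z = G' at *
  field_simp
  linear_combination F z * ode

/-! ### Contradiction at the first failure point -/

theorem mainTheorem2 (α : ℝ) (hα₀ : 0 ≤ α) (hα₁ : α < 1)
    (a b c : ℂ) (hab : a * b ≠ 0) (hc : ∀ n : ℕ, c ≠ -(n : ℂ))
    (p : ℝ) (hp : (p : ℂ) = a + b + 1 - c)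
    (hre : p * (1 - α) < (a * b).re)
    (L M N : ℝ)
    (hL : L = (a * b).re / (1 - α) + p * (1 - 2 * α) - ‖a‖ ^ 2 - ‖b‖ ^ 2 + ‖c - 1‖ ^ 2
      - 4 * a.im * b.im)
    (hM : M = (a * b * ((starRingEnd ℂ) a + (starRingEnd ℂ) b - 2 + 2 * (α : ℂ))).im / (1 - α))
    (hN : N = (a * b).re / (1 - α) + p * (1 - 2 * α) - ‖a‖ ^ 2 - ‖b‖ ^ 2 + ‖c - 1‖ ^ 2
      - (2 * a.re - ‖a‖ ^ 2 / (1 - α)) * (2 * b.re - ‖b‖ ^ 2 / (1 - α)))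
    (hL₀ : 0 ≤ L) (hN₀ : 0 ≤ N) (hLMN : 0 ≤ L * N - M ^ 2) :
    StarlikeOfOrder α (shiftedHypergeometric a b c) := by
  have hβ : 0 < 1 - α := by linarith
  obtain ⟨F, hF⟩ : ∃ F : ℂ → ℂ, F = ordinaryHypergeometric a b c := ⟨_, rfl⟩
  have hf : shiftedHypergeometric a b c = fun z : ℂ => z * F z := by
    rw [hF]; rfl
  have hF0 : F 0 = 1 := by rw [hF]; exact ordinaryHypergeometric_zero a b c
  have hd : DifferentiableOn ℂ F (ball 0 1) := by
    rw [hF]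
    exact differentiableOn_of_hasSum (summable_norm_ordinaryHypergeometricCoefficient a b c)
      fun z hz => hasSum_ordinaryHypergeometric a b c hz
  have hderiv : ∀ z ∈ ball (0 : ℂ) 1, deriv (fun z => z * F z) z = F z + z * deriv F z := by
    intro z hz
    simpa using ((hasDerivAt_id' z).fun_mul
      (hd.differentiableAt (isOpen_ball.mem_nhds hz)).hasDerivAt).deriv
  have hgood : ∀ z ∈ ball (0 : ℂ) 1, F z ≠ 0 ∧ -(1 - α) < (z * deriv F z / F z).re := by
    by_contra! hbad
    obtain ⟨z₁, hz₁, hb⟩ := hbad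
    obtain ⟨z₀, hz₀, hne, hFz₀, hre₀, hlt⟩ := exists_first_re_logDeriv_eq hβ (by linarith) hd
      (by simp [hF0]) ⟨z₁, hz₁, or_iff_not_imp_left.2 hb⟩
    obtain ⟨w, hw⟩ : ∃ w : ℂ → ℂ, w = fun z => z * deriv F z / F z := ⟨_, rfl⟩
    have hz₀n := mem_ball_zero_iff.1 hz₀
    have hwd : ∀ z ∈ ball (0 : ℂ) 1, F z ≠ 0 → DifferentiableAt ℂ w z := by
      intro z hz hFz
      have hn := isOpen_ball.mem_nhds hz
      rw [hw]
      exact (differentiableAt_id.mul ((hd.deriv isOpen_ball).differentiableAt hn)).div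
        (hd.differentiableAt hn) hFz
    have hwz : ∀ z, w z = z * deriv F z / F z := fun z => by rw [hw]
    simp only [← hwz] at hre₀ hlt
    obtain ⟨s, hs, hzw⟩ := exists_mul_deriv_eq_neg_of_re_eq hβ hne
      (fun z hz => (hwd z (ball_subset_ball hz₀n.le hz) (hlt z hz).1).differentiableWithinAt)
      (hwd z₀ hz₀ hFz₀).hasDerivAt (by simp [hw]) (fun z hz => (hlt z hz).2) hre₀
    have hric := ordinaryHypergeometric_riccati hc hz₀ hF hd hFz₀ hw
    rw [hzw] at hric
    have hle := hypergeometric_boundary_norm_le hα₁ hp hre hL hM hN hL₀ hN₀ hLMN hre₀ hs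
    rw [hric, norm_mul] at hle
    -- Now `|B| ≤ |z₀| |B|` with `|z₀| < 1`.
    have hB : -(s : ℂ) + w z₀ ^ 2 + (a + b) * w z₀ + a * b = 0 := by
      by_contra h
      have := norm_pos_iff.2 h
      nlinarith
    rw [hB, mul_zero] at hric
    have hdiff : (p : ℂ) * w z₀ + a * b = 0 := by
      linear_combination hB - hric + w z₀ * hp
    have := congrArg Complex.re hdiff
    rw [Complex.add_re, Complex.re_ofReal_mul, hre₀, Complex.zero_re] at this
    linarith
  rw [hf]
  refine ⟨DifferentiableOn.analyticOnNhd (differentiableOn_id.mul hd) isOpen_ball, by simp, ?_, ?_⟩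
  · rw [hderiv 0 (by simp)]
    simp [hF0]
  · intro z hz hz0
    obtain ⟨h1, h2⟩ := hgood z hz
    refine ⟨mul_ne_zero hz0 h1, ?_⟩
    have e : z * deriv (fun z => z * F z) z / (z * F z) = 1 + z * deriv F z / F z := by
      rw [hderiv z hz]
      field_simp
    rw [e, Complex.add_re, Complex.one_re]
    linarith
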